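/- Let $\mathbb{H}$ be the skew field of quaternions, with Euclidean norm $|\cdot|$, and let $\mathbb{S}=\{I\in\mathbb{H} : \operatorname{Re} I=0,\ |I|=1\}$ be the sphere of imaginary units. A function $f$ on an open set $U\subseteq\mathbb{H}$ with values in $\mathbb{H}$ is called (left) slice regular on $U$ if it is real differentiable on $U$ and, for every $I\in\mathbb{S}$, $$\frac12\left(\frac{\partial}{\partial x}+I\frac{\partial}{\partial y}\right)f(x+Iy)=0\qquad\text{for all } x,y\in\mathbb{R} \text{ with } x+Iy\in U .$$ Put $M_f(R)=\max_{|q|=R}|f(q)|$. **Theorem.** Let $f$ be slice regular on an open set containing the closed ball $\{q\in\mathbb{H} : |q|\le R\}$. Suppose that $f$ has no zeros in that ball and that $f(0)=1$. Then, for every $r<R$ and every $q\in\mathbb{H}$ with $|q|\le r$, $$\log|f(q)|\ \ge\ -\frac{3r+R}{R-r}\,\log M_f(R).$$ -/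

import Mathlib

/-- The sphere `𝕊` of imaginary units: the purely imaginary quaternions of norm one. -/
def imaginaryUnits : Set (Quaternion ℝ) :=
  {I | I.re = 0 ∧ ‖I‖ = 1}

/-- The operator `∂̄_I f (x + I y) = (1/2) (∂/∂x + I ∂/∂y) f_I (x + I y)`, where `f_I` is the
restriction of `f` to the plane `ℂ_I = ℝ + I ℝ`. -/
noncomputable def dbar (I : Quaternion ℝ) (f : Quaternion ℝ → Quaternion ℝ) (x y : ℝ) :
    Quaternion ℝ :=
  (1 / 2 : ℝ) •
    (deriv (fun s : ℝ => f ((s : Quaternion ℝ) + I * (y : Quaternion ℝ))) x +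
      I * deriv (fun t : ℝ => f ((x : Quaternion ℝ) + I * (t : Quaternion ℝ))) y)

/-- (Left) slice regular functions on an open set `U` of quaternions: `f` is real differentiable
on `U`, and `∂̄_I f = 0` on `U ∩ ℂ_I` for every imaginary unit `I`. -/
structure SliceRegularOn (f : Quaternion ℝ → Quaternion ℝ) (U : Set (Quaternion ℝ)) : Prop where
  isOpen : IsOpen U
  differentiableOn : DifferentiableOn ℝ f U
  dbar_eq_zero : ∀ I ∈ imaginaryUnits, ∀ x y : ℝ,
    (x : Quaternion ℝ) + I * (y : Quaternion ℝ) ∈ U → dbar I f x y = 0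

/-- `M_f(r) = max_{|q| = r} |f(q)|`. -/
noncomputable def maxModulus (f : Quaternion ℝ → Quaternion ℝ) (r : ℝ) : ℝ :=
  sSup ((fun q => ‖f q‖) '' Metric.sphere (0 : Quaternion ℝ) r)

/-- The supremum defining `M_f(r)` is a maximum whenever `f` is continuous on the sphere. -/
theorem isGreatest_maxModulus {f : Quaternion ℝ → Quaternion ℝ} {r : ℝ} (hr : 0 ≤ r)
    (hf : ContinuousOn f (Metric.sphere (0 : Quaternion ℝ) r)) :
    IsGreatest ((fun q => ‖f q‖) '' Metric.sphere (0 : Quaternion ℝ) r) (maxModulus f r) := by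
  have : ProperSpace (Quaternion ℝ) := FiniteDimensional.proper ℝ _
  refine ((isCompact_sphere (0 : Quaternion ℝ) r).image_of_continuousOn hf.norm).isGreatest_sSup ?_
  refine Set.Nonempty.image _ ⟨(r : Quaternion ℝ), ?_⟩
  simp [Quaternion.norm_coe, abs_of_nonneg hr]

/-! On a ball, `f (x + J y) = α + J β` for a single holomorphic stem function `α + i β`, whatever
the unit `J` (`SliceRegularOn.exists_stem`). Its symmetrization `|α|² - |β|² + 2i⟪α, β⟫` is an
ordinary holomorphic function `h` with `h 0 = 1`, and `|h|` is a product of two values of `|f|` on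
the sphere `x + 𝕊 y`, the first at any chosen point (`exists_norm_stemNorm_eq`). Hence `h` has no
zeros and `|h| ≤ M²`, so Carathéodory's inequality gives `log |h| ≥ -4r/(R - r) · log M`. Since `|h|
≤ |f| M`, passing to `f` costs one more `log M`, and `4r/(R - r) + 1 = (3r + R)/(R - r)`. -/

open scoped Quaternion InnerProductSpace

/-- The real linear embedding `x + iy ↦ x + Jy` of `ℂ` into the quaternions. -/
noncomputable def sliceMap (J : ℍ[ℝ]) : ℂ →L[ℝ] ℍ[ℝ] :=
  Complex.reCLM.smulRight 1 + Complex.imCLM.smulRight J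

theorem sliceMap_apply (J : ℍ[ℝ]) (z : ℂ) :
    sliceMap J z = (z.re : ℍ[ℝ]) + J * (z.im : ℍ[ℝ]) := by
  simp [sliceMap, Quaternion.mul_coe_eq_smul, ← Algebra.algebraMap_eq_smul_one]

theorem sliceMap_ofReal (J : ℍ[ℝ]) (x : ℝ) : sliceMap J x = (x : ℍ[ℝ]) := by
  simp [sliceMap_apply]

theorem mul_self_of_mem_imaginaryUnits {J : ℍ[ℝ]} (hJ : J ∈ imaginaryUnits) : J * J = -1 := by
  obtain ⟨h0, h1⟩ := hJ
  have h2 := Quaternion.self_mul_star J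
  rw [Quaternion.star_eq_neg.mpr h0, Quaternion.normSq_eq_norm_mul_self, h1] at h2
  simpa [neg_eq_iff_eq_neg] using h2

theorem neg_mem_imaginaryUnits {J : ℍ[ℝ]} (hJ : J ∈ imaginaryUnits) : -J ∈ imaginaryUnits := by
  simpa [imaginaryUnits] using hJ

theorem norm_sliceMap {J : ℍ[ℝ]} (hJ : J ∈ imaginaryUnits) (z : ℂ) : ‖sliceMap J z‖ = ‖z‖ := by
  have h : ‖sliceMap J z‖ ^ 2 = ‖z‖ ^ 2 := by
    have h1 := hJ.2
    have h2 : ‖J‖ * ‖J‖ = 1 := by rw [h1]; norm_num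
    have h3 := hJ.1
    rw [← Quaternion.normSq_eq_norm_mul_self, Quaternion.normSq_def'] at h2
    rw [pow_two, ← Quaternion.normSq_eq_norm_mul_self, Quaternion.normSq_def', Complex.sq_norm,
      Complex.normSq_apply, sliceMap_apply]
    simp [h3] at h2 ⊢
    linear_combination z.im ^ 2 * h2
  exact (sq_eq_sq₀ (norm_nonneg _) (norm_nonneg _)).mp h

theorem imaginaryUnits_nonempty : imaginaryUnits.Nonempty := by
  obtain ⟨J, h0, h1, h2, h3⟩ :
      ∃ J : ℍ[ℝ], J.re = 0 ∧ J.imI = 1 ∧ J.imJ = 0 ∧ J.imK = 0 :=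
    ⟨⟨0, 1, 0, 0⟩, rfl, rfl, rfl, rfl⟩
  have h : ‖J‖ * ‖J‖ = 1 := by
    rw [← Quaternion.normSq_eq_norm_mul_self, Quaternion.normSq_def', h0, h1, h2, h3]
    norm_num
  exact ⟨J, h0, by nlinarith [norm_nonneg J]⟩

/-- Every quaternion lies on a slice. -/
theorem exists_sliceMap_eq (q : ℍ[ℝ]) : ∃ J ∈ imaginaryUnits, ∃ z : ℂ, sliceMap J z = q := by
  by_cases h : q.im = 0
  · obtain ⟨J, hJ⟩ := imaginaryUnits_nonempty
    refine ⟨J, hJ, q.re, ?_⟩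
    rw [sliceMap_ofReal]
    conv_rhs => rw [← Quaternion.re_add_im q, h, add_zero]
  · have hn : ‖q.im‖ ≠ 0 := norm_ne_zero_iff.mpr h
    refine ⟨‖q.im‖⁻¹ • q.im, ⟨by simp, ?_⟩, ⟨q.re, ‖q.im‖⟩, ?_⟩
    · rw [norm_smul, norm_inv, norm_norm, inv_mul_cancel₀ hn]
    · rw [sliceMap_apply, Quaternion.mul_coe_eq_smul, smul_smul]
      simp only [mul_inv_cancel₀ hn, one_smul, Quaternion.re_add_im]

/-- Holomorphy at `z`, for the complex structure on `ℍ` given by left multiplication by `J`. -/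
def SliceHolomorphicAt (J : ℍ[ℝ]) (g : ℂ → ℍ[ℝ]) (z : ℂ) : Prop :=
  ∃ D : ℂ →L[ℝ] ℍ[ℝ], HasFDerivAt g D z ∧ D Complex.I = J * D 1

theorem SliceHolomorphicAt.sub {J : ℍ[ℝ]} {g k : ℂ → ℍ[ℝ]} {z : ℂ}
    (hg : SliceHolomorphicAt J g z) (hk : SliceHolomorphicAt J k z) :
    SliceHolomorphicAt J (fun z => g z - k z) z := by
  obtain ⟨D, hD, h1⟩ := hg
  obtain ⟨E, hE, h2⟩ := hk
  exact ⟨D - E, hD.sub hE, by simp [h1, h2, mul_sub]⟩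

theorem SliceRegularOn.sliceHolomorphicAt {f : ℍ[ℝ] → ℍ[ℝ]} {U : Set ℍ[ℝ]}
    (hf : SliceRegularOn f U) {J : ℍ[ℝ]} (hJ : J ∈ imaginaryUnits) {z : ℂ}
    (hz : sliceMap J z ∈ U) : SliceHolomorphicAt J (fun z => f (sliceMap J z)) z := by
  have hd := (hf.differentiableOn.differentiableAt (hf.isOpen.mem_nhds hz)).hasFDerivAt
  set D := fderiv ℝ f (sliceMap J z) with hD
  refine ⟨D.comp (sliceMap J), hd.comp z (sliceMap J).hasFDerivAt, ?_⟩
  have h0 := hf.dbar_eq_zero J hJ z.re z.im (by rwa [sliceMap_apply] at hz)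
  rw [sliceMap_apply] at hd
  have hx : HasDerivAt (fun s : ℝ => f ((s : ℍ[ℝ]) + J * (z.im : ℍ[ℝ]))) (D 1) z.re := by
    refine hd.comp_hasDerivAt z.re (f := fun s : ℝ => (s : ℍ[ℝ]) + J * (z.im : ℍ[ℝ])) ?_
    have : HasDerivAt (fun s : ℝ => s • (1 : ℍ[ℝ])) (1 : ℍ[ℝ]) z.re := by
      simpa using (hasDerivAt_id z.re).smul_const (1 : ℍ[ℝ])
    simpa only [← Quaternion.mul_coe_eq_smul, one_mul] using this.add_const (J * (z.im : ℍ[ℝ]))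
  have hy : HasDerivAt (fun s : ℝ => f ((z.re : ℍ[ℝ]) + J * (s : ℍ[ℝ]))) (D J) z.im := by
    refine hd.comp_hasDerivAt z.im (f := fun s : ℝ => (z.re : ℍ[ℝ]) + J * (s : ℍ[ℝ])) ?_
    have : HasDerivAt (fun s : ℝ => s • J) J z.im := by
      simpa using (hasDerivAt_id z.im).smul_const J
    simpa only [Quaternion.mul_coe_eq_smul] using this.const_add (z.re : ℍ[ℝ])
  rw [dbar, hx.deriv, hy.deriv, smul_eq_zero] at h0
  have h1 : D 1 + J * D J = 0 := h0.resolve_left (by norm_num)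
  have e1 : sliceMap J 1 = 1 := by simp [sliceMap_apply]
  have e2 : sliceMap J Complex.I = J := by simp [sliceMap_apply]
  simp only [ContinuousLinearMap.comp_apply, e1, e2]
  rw [eq_neg_of_add_eq_zero_left h1, mul_neg, ← mul_assoc, mul_self_of_mem_imaginaryUnits hJ]
  simp

/-! ### Reduction of one slice to scalar holomorphic functions -/

/-- The complex functional `v ↦ ⟪w, v⟫ - i ⟪w, J v⟫` on the quaternions. -/
noncomputable def sliceFunctional (J w : ℍ[ℝ]) : ℍ[ℝ] →L[ℝ] ℂ :=
  Complex.ofRealCLM.comp (innerSL ℝ w) -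
    Complex.I • Complex.ofRealCLM.comp ((innerSL ℝ w).comp (ContinuousLinearMap.mul ℝ ℍ[ℝ] J))

theorem sliceFunctional_apply (J w v : ℍ[ℝ]) :
    sliceFunctional J w v = (⟪w, v⟫_ℝ : ℂ) - Complex.I * (⟪w, J * v⟫_ℝ : ℂ) := by
  simp [sliceFunctional]

theorem sliceFunctional_re (J w v : ℍ[ℝ]) : (sliceFunctional J w v).re = ⟪w, v⟫_ℝ := by
  simp [sliceFunctional_apply]

theorem sliceFunctional_mul {J : ℍ[ℝ]} (hJ : J ∈ imaginaryUnits) (w v : ℍ[ℝ]) :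
    sliceFunctional J w (J * v) = Complex.I * sliceFunctional J w v := by
  rw [sliceFunctional_apply, sliceFunctional_apply, ← mul_assoc,
    mul_self_of_mem_imaginaryUnits hJ]
  simp
  ring_nf
  simp

/-- Multiplying `v` by the conjugate of the value `c` makes the functional equal to `|c|²`, which is
real; Cauchy–Schwarz then applies. -/
theorem norm_sliceFunctional_le {J : ℍ[ℝ]} (hJ : J ∈ imaginaryUnits) (w v : ℍ[ℝ]) :
    ‖sliceFunctional J w v‖ ≤ ‖w‖ * ‖v‖ := by
  set c := sliceFunctional J w v with hc
  have h1 : ⟪w, sliceMap J ((starRingEnd ℂ) c) * v⟫_ℝ = ‖c‖ ^ 2 := by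
    have h2 : sliceFunctional J w (sliceMap J ((starRingEnd ℂ) c) * v) =
        (starRingEnd ℂ) c * c := by
      rw [sliceMap_apply, add_mul, map_add, Quaternion.coe_mul_eq_smul, mul_assoc,
        sliceFunctional_mul hJ, Quaternion.coe_mul_eq_smul, map_smul, map_smul, ← hc]
      conv_rhs => rw [← Complex.re_add_im ((starRingEnd ℂ) c)]
      simp only [Complex.real_smul]
      ring
    rw [← sliceFunctional_re J, h2, mul_comm, Complex.mul_conj, Complex.ofReal_re,
      Complex.sq_norm]
  have h3 := real_inner_le_norm w (sliceMap J ((starRingEnd ℂ) c) * v)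
  rw [h1, norm_mul, norm_sliceMap hJ, RCLike.norm_conj] at h3
  rcases (norm_nonneg c).eq_or_lt with h | h
  · rw [← h]; positivity
  · nlinarith

theorem SliceHolomorphicAt.differentiableAt_sliceFunctional {J : ℍ[ℝ]}
    (hJ : J ∈ imaginaryUnits) {g : ℂ → ℍ[ℝ]} {z : ℂ} (hg : SliceHolomorphicAt J g z)
    (w : ℍ[ℝ]) : DifferentiableAt ℂ (fun z => sliceFunctional J w (g z)) z := by
  obtain ⟨D, hD, h⟩ := hg
  have h1 : HasFDerivAt (fun z => sliceFunctional J w (g z)) ((sliceFunctional J w).comp D) z :=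
    (sliceFunctional J w).hasFDerivAt.comp z hD
  rw [differentiableAt_complex_iff_differentiableAt_real]
  refine ⟨h1.differentiableAt, ?_⟩
  rw [h1.fderiv]
  simp [h, sliceFunctional_mul hJ]

theorem norm_le_of_sliceHolomorphicAt {J : ℍ[ℝ]} (hJ : J ∈ imaginaryUnits) {g : ℂ → ℍ[ℝ]}
    {R M : ℝ} (hg : ∀ z ∈ Metric.closedBall (0 : ℂ) R, SliceHolomorphicAt J g z)
    (hM : ∀ z ∈ Metric.sphere (0 : ℂ) R, ‖g z‖ ≤ M) {z : ℂ}
    (hz : z ∈ Metric.closedBall (0 : ℂ) R) : ‖g z‖ ≤ M := by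
  rcases eq_or_ne (g z) 0 with h | h
  · rcases eq_or_lt_of_le (mem_closedBall_zero_iff.mp hz) with h2 | h2
    · exact hM z (by simpa using h2)
    · have h3 : 0 ≤ R := (norm_nonneg z).trans h2.le
      rw [h, norm_zero]
      exact (norm_nonneg _).trans (hM (R : ℂ) (by simp [abs_of_nonneg h3]))
  rcases eq_or_ne R 0 with hR | hR
  · exact hM z (by subst hR; simpa using hz)
  -- The functional attached to `g z` has real part `‖g z‖²` at `g z`, so the scalar maximum
  -- principle loses nothing.
  have key : ‖sliceFunctional J (g z) (g z)‖ ≤ ‖g z‖ * M := by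
    refine Complex.norm_le_of_forall_mem_frontier_norm_le
      (f := fun x => sliceFunctional J (g z) (g x)) (U := Metric.ball 0 R)
      Metric.isBounded_ball ?_ ?_ ?_
    · refine DifferentiableOn.diffContOnCl fun x hx => ?_
      rw [closure_ball _ hR] at hx
      exact ((hg x hx).differentiableAt_sliceFunctional hJ _).differentiableWithinAt
    · intro x hx
      rw [frontier_ball _ hR] at hx
      exact (norm_sliceFunctional_le hJ _ _).trans (by gcongr; exact hM x hx)
    · rwa [closure_ball _ hR]
  have h4 : ‖g z‖ * ‖g z‖ ≤ ‖sliceFunctional J (g z) (g z)‖ := by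
    rw [← real_inner_self_eq_norm_mul_norm, ← sliceFunctional_re J]
    exact Complex.re_le_norm _
  exact le_of_mul_le_mul_left (h4.trans key) (norm_pos_iff.mpr h)

theorem eq_zero_of_sliceHolomorphicAt {J : ℍ[ℝ]} (hJ : J ∈ imaginaryUnits) {g : ℂ → ℍ[ℝ]}
    {R : ℝ} (hg : ∀ z ∈ Metric.ball (0 : ℂ) R, SliceHolomorphicAt J g z)
    (h0 : ∀ x : ℝ, |x| < R → g x = 0) {z : ℂ} (hz : z ∈ Metric.ball (0 : ℂ) R) : g z = 0 := by
  have hR : 0 < R := Metric.pos_of_mem_ball hz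
  have hd : DifferentiableOn ℂ (fun x => sliceFunctional J (g z) (g x)) (Metric.ball 0 R) :=
    fun x hx => ((hg x hx).differentiableAt_sliceFunctional hJ _).differentiableWithinAt
  have ha := hd.analyticOnNhd Metric.isOpen_ball
  have hf : ∃ᶠ x in nhdsWithin (0 : ℂ) {0}ᶜ, sliceFunctional J (g z) (g x) = 0 := by
    have ht : Filter.Tendsto (fun x : ℝ => (x : ℂ)) (nhdsWithin 0 {0}ᶜ)
        (nhdsWithin (0 : ℂ) {0}ᶜ) := by
      refine tendsto_nhdsWithin_iff.mpr ⟨?_, ?_⟩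
      · exact (Complex.continuous_ofReal.tendsto' 0 0 (by simp)).mono_left nhdsWithin_le_nhds
      · filter_upwards [self_mem_nhdsWithin] with x hx
        simpa using hx
    refine ht.frequently (Filter.Eventually.frequently ?_)
    filter_upwards [nhdsWithin_le_nhds (Metric.ball_mem_nhds (0 : ℝ) hR)] with x hx
    rw [h0 x (by simpa using hx), map_zero]
  have h1 := ha.eqOn_zero_of_preconnected_of_frequently_eq_zero
    (convex_ball (0 : ℂ) R).isPreconnected (Metric.mem_ball_self hR) hf hz
  have h2 : ⟪g z, g z⟫_ℝ = 0 := by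
    rw [← sliceFunctional_re J, show sliceFunctional J (g z) (g z) = 0 from h1, Complex.zero_re]
  exact inner_self_eq_zero.mp h2

theorem conj_mem_imaginaryUnits {J v : ℍ[ℝ]} (hJ : J ∈ imaginaryUnits) (hv : v ≠ 0) :
    v * J * v⁻¹ ∈ imaginaryUnits := by
  have hre : ∀ x y : ℍ[ℝ], (x * y).re = (y * x).re := fun x y => by
    simp only [Quaternion.re_mul]; ring
  refine ⟨?_, ?_⟩
  · rw [hre, ← mul_assoc, inv_mul_cancel₀ hv, one_mul, hJ.1]
  · rw [norm_mul, norm_mul, hJ.2, norm_inv, mul_one, mul_inv_cancel₀ (norm_ne_zero_iff.mpr hv)]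

/-! ### Symmetrization -/

/-- The value of the symmetrization `f * f^c` at a point where the stem function of `f` takes
the value `a + i b`. -/
noncomputable def stemNorm (a b : ℍ[ℝ]) : ℂ :=
  ((⟪a, a⟫_ℝ - ⟪b, b⟫_ℝ : ℝ) : ℂ) + ((2 * ⟪a, b⟫_ℝ : ℝ) : ℂ) * Complex.I

theorem stemNorm_re (a b : ℍ[ℝ]) : (stemNorm a b).re = ⟪a, a⟫_ℝ - ⟪b, b⟫_ℝ := by
  simp [stemNorm, -Complex.ofReal_sub, -Complex.ofReal_mul]

theorem stemNorm_im (a b : ℍ[ℝ]) : (stemNorm a b).im = 2 * ⟪a, b⟫_ℝ := by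
  simp [stemNorm, -Complex.ofReal_sub, -Complex.ofReal_mul]

/-- Vanishing means `|a| = |b|` and `a ⊥ b`, so for `b ≠ 0` the quotient `-a b⁻¹` is itself an
imaginary unit. -/
theorem exists_add_mul_eq_zero_of_stemNorm_eq_zero {a b : ℍ[ℝ]} (h : stemNorm a b = 0) :
    ∃ J ∈ imaginaryUnits, a + J * b = 0 := by
  have hre : ⟪a, a⟫_ℝ - ⟪b, b⟫_ℝ = 0 := by
    rw [← stemNorm_re, h, Complex.zero_re]
  have him : ⟪a, b⟫_ℝ = 0 := by
    have := stemNorm_im a b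
    rw [h, Complex.zero_im] at this
    linarith
  rw [real_inner_self_eq_norm_sq, real_inner_self_eq_norm_sq, sub_eq_zero,
    sq_eq_sq₀ (norm_nonneg _) (norm_nonneg _)] at hre
  rcases eq_or_ne b 0 with rfl | hb
  · obtain ⟨J, hJ⟩ := imaginaryUnits_nonempty
    exact ⟨J, hJ, by simpa using hre⟩
  · refine ⟨-(a * b⁻¹), ⟨?_, ?_⟩, ?_⟩
    · rw [Quaternion.inner_def] at him
      rw [Quaternion.inv_def, mul_smul_comm, Quaternion.re_neg, Quaternion.re_smul, him]
      simp
    · rw [norm_neg, norm_mul, norm_inv, hre, mul_inv_cancel₀ (norm_ne_zero_iff.mpr hb)]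
    · rw [neg_mul, mul_assoc, inv_mul_cancel₀ hb, mul_one, add_neg_cancel]

theorem sliceMap_stemNorm {J : ℍ[ℝ]} (hJ : J ∈ imaginaryUnits) (a b : ℍ[ℝ]) :
    sliceMap J (stemNorm a b) = (a + J * b) * star a + J * (a + J * b) * star b := by
  have h1 : a * star b + b * star a = ((2 * ⟪a, b⟫_ℝ : ℝ) : ℍ[ℝ]) := by
    have := Quaternion.self_add_star (a * star b)
    rw [star_mul, star_star] at this
    rw [this, Quaternion.inner_def, two_mul, two_mul, Quaternion.coe_add]
  have h2 : (a + J * b) * star a + J * (a + J * b) * star b =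
      a * star a + J * J * (b * star b) + J * (a * star b + b * star a) := by
    noncomm_ring
  rw [h2, h1, mul_self_of_mem_imaginaryUnits hJ, Quaternion.self_mul_star,
    Quaternion.self_mul_star, sliceMap_apply, stemNorm_re, stemNorm_im, Quaternion.inner_self,
    Quaternion.inner_self]
  simp [sub_eq_add_neg]

/-- `|f^s| = |f| |f^c ∘ T|` on a sphere `x + 𝕊 y`, in terms of the values of the stem function. -/
theorem exists_norm_stemNorm_eq {J : ℍ[ℝ]} (hJ : J ∈ imaginaryUnits) {a b : ℍ[ℝ]}
    (h : a + J * b ≠ 0) :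
    ∃ K ∈ imaginaryUnits, ‖stemNorm a b‖ = ‖a + J * b‖ * ‖a + K * b‖ := by
  -- With `L = v⁻¹ J v`, the symmetrization `v ā + J v b̄` factors as `v (ā + L b̄)`, and the second
  -- factor is the conjugate of `a - b L`. Conjugating `L` by `b` moves it to the left of `b`.
  set v := a + J * b with hv
  have hL : v⁻¹ * J * v ∈ imaginaryUnits := by
    simpa using conj_mem_imaginaryUnits hJ (inv_ne_zero h)
  have key : ‖stemNorm a b‖ = ‖v‖ * ‖a - b * (v⁻¹ * J * v)‖ := by
    rw [← norm_sliceMap hJ, sliceMap_stemNorm hJ, ← hv, ← Quaternion.norm_star (a - _), star_sub,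
      star_mul, Quaternion.star_eq_neg.mpr hL.1, ← norm_mul, mul_sub, neg_mul, mul_neg,
      sub_neg_eq_add]
    simp only [mul_assoc, mul_inv_cancel_left₀ h]
  rcases eq_or_ne b 0 with hb | hb
  · exact ⟨J, hJ, by simpa [hb] using key⟩
  · refine ⟨-(b * (v⁻¹ * J * v) * b⁻¹), neg_mem_imaginaryUnits (conj_mem_imaginaryUnits hL hb), ?_⟩
    rw [key, neg_mul, mul_assoc _ b⁻¹, inv_mul_cancel₀ hb, mul_one, sub_eq_add_neg]

/-! ### Stem functions -/

/-- The Cauchy–Riemann equations at `z` for the stem function `α + i β`. -/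
def StemHolomorphicAt (α β : ℂ → ℍ[ℝ]) (z : ℂ) : Prop :=
  ∃ A B : ℂ →L[ℝ] ℍ[ℝ], HasFDerivAt α A z ∧ HasFDerivAt β B z ∧
    A Complex.I = -B 1 ∧ B Complex.I = A 1

theorem StemHolomorphicAt.sliceHolomorphicAt {α β : ℂ → ℍ[ℝ]} {z : ℂ}
    (h : StemHolomorphicAt α β z) {J : ℍ[ℝ]} (hJ : J ∈ imaginaryUnits) :
    SliceHolomorphicAt J (fun z => α z + J * β z) z := by
  obtain ⟨A, B, hA, hB, h1, h2⟩ := h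
  refine ⟨A + (ContinuousLinearMap.mul ℝ ℍ[ℝ] J).comp B,
    hA.add ((ContinuousLinearMap.mul ℝ ℍ[ℝ] J).hasFDerivAt.comp z hB), ?_⟩
  simp [h1, h2, mul_add, ← mul_assoc, mul_self_of_mem_imaginaryUnits hJ, add_comm]

/-- `stemNorm` is the complex bilinear extension of the inner product, evaluated on the diagonal at
`α + i β`. -/
theorem StemHolomorphicAt.differentiableAt_stemNorm {α β : ℂ → ℍ[ℝ]} {z : ℂ}
    (h : StemHolomorphicAt α β z) :
    DifferentiableAt ℂ (fun z => stemNorm (α z) (β z)) z := by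
  obtain ⟨A, B, hA, hB, h1, h2⟩ := h
  have hd := (Complex.ofRealCLM.hasFDerivAt.comp z ((hA.inner ℝ hA).sub (hB.inner ℝ hB))).add
    ((Complex.ofRealCLM.hasFDerivAt.comp z ((hA.inner ℝ hB).const_mul 2)).mul_const Complex.I)
  have hd' : HasFDerivAt (𝕜 := ℝ) (fun z => stemNorm (α z) (β z)) _ z := hd
  rw [differentiableAt_complex_iff_differentiableAt_real]
  refine ⟨hd'.differentiableAt, ?_⟩
  rw [hd'.fderiv]
  apply Complex.ext <;>
    simp [h1, h2, real_inner_comm] <;> ring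

/-- Slice regular functions on a ball are induced by a stem function. -/
theorem SliceRegularOn.exists_stem {f : ℍ[ℝ] → ℍ[ℝ]} {U : Set ℍ[ℝ]} {R : ℝ}
    (hf : SliceRegularOn f U) (hU : Metric.ball 0 R ⊆ U) :
    ∃ α β : ℂ → ℍ[ℝ], (∀ z ∈ Metric.ball (0 : ℂ) R, StemHolomorphicAt α β z) ∧
      ∀ J ∈ imaginaryUnits, ∀ z ∈ Metric.ball (0 : ℂ) R, f (sliceMap J z) = α z + J * β z := by
  obtain ⟨i, hi⟩ := imaginaryUnits_nonempty
  have hmem : ∀ J ∈ imaginaryUnits, ∀ z ∈ Metric.ball (0 : ℂ) R, sliceMap J z ∈ U := by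
    intro J hJ z hz
    apply hU
    rw [mem_ball_zero_iff] at hz ⊢
    rwa [norm_sliceMap hJ]
  have hi' := neg_mem_imaginaryUnits hi
  have hii := mul_self_of_mem_imaginaryUnits hi
  have hst : ∀ z ∈ Metric.ball (0 : ℂ) R, StemHolomorphicAt
      (fun z => (1 / 2 : ℝ) • (f (sliceMap i z) + f (sliceMap (-i) z)))
      (fun z => (1 / 2 : ℝ) • (-i * (f (sliceMap i z) - f (sliceMap (-i) z)))) z := by
    intro z hz
    obtain ⟨D, hD, h1⟩ := hf.sliceHolomorphicAt hi (hmem i hi z hz)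
    obtain ⟨E, hE, h2⟩ := hf.sliceHolomorphicAt hi' (hmem _ hi' z hz)
    refine ⟨_, _, (hD.add hE).const_smul (1 / 2 : ℝ),
      ((ContinuousLinearMap.mul ℝ ℍ[ℝ] (-i)).hasFDerivAt.comp z (hD.sub hE)).const_smul
        (1 / 2 : ℝ), ?_, ?_⟩
    · simp [h1, h2, sub_eq_add_neg, add_comm]
    · simp [h1, h2, ← mul_assoc, hii]
  refine ⟨_, _, hst, fun J hJ z hz => ?_⟩
  -- Both sides are holomorphic on the slice of `J` and agree on the real axis, where `sliceMap`
  -- does not depend on the unit.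
  rw [← sub_eq_zero]
  refine eq_zero_of_sliceHolomorphicAt hJ
    (fun z hz => (hf.sliceHolomorphicAt hJ (hmem J hJ z hz)).sub
      ((hst z hz).sliceHolomorphicAt hJ)) (fun x _ => ?_) hz
  simp only [sliceMap_ofReal, sub_self, mul_zero, smul_zero, add_zero]
  rw [← two_smul ℝ, smul_smul]
  norm_num

/-! ### Carathéodory's inequality and the conclusion -/

theorem exists_log_of_differentiableOn_ball {h : ℂ → ℂ} {R : ℝ}
    (hd : DifferentiableOn ℂ h (Metric.ball 0 R)) (hne : ∀ z ∈ Metric.ball (0 : ℂ) R, h z ≠ 0)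
    (h0 : h 0 = 1) :
    ∃ g : ℂ → ℂ, DifferentiableOn ℂ g (Metric.ball 0 R) ∧ g 0 = 0 ∧
      ∀ z ∈ Metric.ball (0 : ℂ) R, Complex.exp (g z) = h z := by
  have hd' : DifferentiableOn ℂ (fun z => deriv h z / h z) (Metric.ball 0 R) :=
    (hd.deriv Metric.isOpen_ball).div hd hne
  obtain ⟨g, hg0, hg⟩ := hd'.isExactOn_ball.with_val_at 0 0
  refine ⟨g, fun z hz => (hg z hz).differentiableAt.differentiableWithinAt, hg0, fun z hz => ?_⟩
  have hk : ∀ x ∈ Metric.ball (0 : ℂ) R, HasDerivAt (fun x => h x * Complex.exp (-g x)) 0 x := by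
    intro x hx
    have h1 := (hd.differentiableAt (Metric.isOpen_ball.mem_nhds hx)).hasDerivAt.mul
      (hg x hx).neg.cexp
    refine h1.congr_deriv ?_
    field_simp [hne x hx]
    ring
  have hc := Metric.isOpen_ball.is_const_of_deriv_eq_zero (convex_ball (0 : ℂ) R).isPreconnected
    (fun x hx => (hk x hx).differentiableAt.differentiableWithinAt)
    (fun x hx => (hk x hx).deriv) hz (Metric.mem_ball_self (Metric.pos_of_mem_ball hz))
  simp only [h0, hg0, Complex.exp_neg, neg_zero, Complex.exp_zero, mul_one] at hc
  field_simp at hc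
  simpa using hc.symm

/-- **Carathéodory's inequality** for zero-free holomorphic functions. -/
theorem log_norm_ge_of_norm_le {h : ℂ → ℂ} {R B : ℝ}
    (hd : DifferentiableOn ℂ h (Metric.ball 0 R)) (hne : ∀ z ∈ Metric.ball (0 : ℂ) R, h z ≠ 0)
    (h0 : h 0 = 1) (hB : ∀ z ∈ Metric.ball (0 : ℂ) R, ‖h z‖ ≤ B) {z : ℂ}
    (hz : z ∈ Metric.ball (0 : ℂ) R) :
    -(2 * Real.log B * ‖z‖ / (R - ‖z‖)) ≤ Real.log ‖h z‖ := by
  obtain ⟨g, hg, hg0, hexp⟩ := exists_log_of_differentiableOn_ball hd hne h0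
  have hR : 0 < R := Metric.pos_of_mem_ball hz
  have hre : ∀ x ∈ Metric.ball (0 : ℂ) R, Real.log ‖h x‖ = (g x).re := fun x hx => by
    rw [← hexp x hx, Complex.norm_exp, Real.log_exp]
  have hle : ∀ x ∈ Metric.ball (0 : ℂ) R, (g x).re ≤ Real.log B := fun x hx => by
    rw [← hre x hx]
    exact Real.log_le_log (norm_pos_iff.mpr (hne x hx)) (hB x hx)
  have hB0 : 0 ≤ Real.log B := by simpa [hg0] using hle 0 (Metric.mem_ball_self hR)
  -- Borel–Carathéodory is applied with a strictly positive bound, while `log B` may be `0`; hence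
  -- the limit `ε → 0⁺`.
  have hlim : ∀ᶠ ε in nhdsWithin (0 : ℝ) (Set.Ioi 0),
      ‖g z‖ ≤ 2 * (Real.log B + ε) * ‖z‖ / (R - ‖z‖) := by
    filter_upwards [self_mem_nhdsWithin] with ε hε
    have hε' : 0 < ε := hε
    exact Complex.borelCaratheodory_zero (by positivity) hg
      (fun x hx => (hle x hx).trans (by linarith)) hR hz hg0
  have hcont : Filter.Tendsto (fun ε : ℝ => 2 * (Real.log B + ε) * ‖z‖ / (R - ‖z‖))
      (nhdsWithin 0 (Set.Ioi 0)) (nhds (2 * Real.log B * ‖z‖ / (R - ‖z‖))) := by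
    refine (Continuous.tendsto' ?_ _ _ (by simp)).mono_left nhdsWithin_le_nhds
    fun_prop
  have hn := ge_of_tendsto hcont hlim
  rw [hre z hz]
  linarith [neg_abs_le (g z).re, Complex.abs_re_le_norm (g z)]

theorem SliceRegularOn.norm_le_maxModulus {f : ℍ[ℝ] → ℍ[ℝ]} {U : Set ℍ[ℝ]} {R : ℝ}
    (hf : SliceRegularOn f U) (hU : Metric.closedBall 0 R ⊆ U) {q : ℍ[ℝ]} (hq : ‖q‖ ≤ R) :
    ‖f q‖ ≤ maxModulus f R := by
  obtain ⟨J, hJ, z, rfl⟩ := exists_sliceMap_eq q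
  have hmax := isGreatest_maxModulus ((norm_nonneg _).trans hq)
    (hf.differentiableOn.continuousOn.mono (Metric.sphere_subset_closedBall.trans hU))
  rw [norm_sliceMap hJ] at hq
  refine norm_le_of_sliceHolomorphicAt hJ (g := fun z => f (sliceMap J z)) (R := R)
    (fun z hz => hf.sliceHolomorphicAt hJ (hU ?_)) (fun z hz => hmax.2 ⟨sliceMap J z, ?_, rfl⟩)
    (by simpa using hq)
  · simpa [norm_sliceMap hJ] using hz
  · simpa [norm_sliceMap hJ] using hz

theorem mainTheorem5 (f : Quaternion ℝ → Quaternion ℝ) (U : Set (Quaternion ℝ)) (R r : ℝ)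
    (hf : SliceRegularOn f U)
    (hRU : Metric.closedBall (0 : Quaternion ℝ) R ⊆ U)
    (hzero : ∀ q : Quaternion ℝ, ‖q‖ ≤ R → f q ≠ 0)
    (hf0 : f 0 = 1)
    (hrR : r < R)
    (q : Quaternion ℝ) (hq : ‖q‖ ≤ r) :
    Real.log ‖f q‖ ≥ -((3 * r + R) / (R - r)) * Real.log (maxModulus f R) := by
  set M := maxModulus f R with hMdef
  have hM : ∀ p : ℍ[ℝ], ‖p‖ ≤ R → ‖f p‖ ≤ M := fun p hp => hf.norm_le_maxModulus hRU hp
  have hr : 0 ≤ r := (norm_nonneg q).trans hq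
  have hR : 0 < R := hr.trans_lt hrR
  have hM1 : 1 ≤ M := by simpa [hf0] using hM 0 (by simpa using hR.le)
  obtain ⟨α, β, hst, hrep⟩ := hf.exists_stem (Metric.ball_subset_closedBall.trans hRU)
  have hslice : ∀ J ∈ imaginaryUnits, ∀ z ∈ Metric.ball (0 : ℂ) R, ‖sliceMap J z‖ ≤ R := by
    intro J hJ z hz
    rw [norm_sliceMap hJ]
    exact (mem_ball_zero_iff.mp hz).le
  have hupper : ∀ J ∈ imaginaryUnits, ∀ z ∈ Metric.ball (0 : ℂ) R,
      ‖stemNorm (α z) (β z)‖ ≤ ‖f (sliceMap J z)‖ * M := by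
    intro J hJ z hz
    have hne := hzero _ (hslice J hJ z hz)
    rw [hrep J hJ z hz] at hne ⊢
    obtain ⟨K, hK, h⟩ := exists_norm_stemNorm_eq hJ hne
    rw [h, ← hrep K hK z hz]
    gcongr
    exact hM _ (hslice K hK z hz)
  have hne : ∀ z ∈ Metric.ball (0 : ℂ) R, stemNorm (α z) (β z) ≠ 0 := by
    intro z hz h
    obtain ⟨J, hJ, h1⟩ := exists_add_mul_eq_zero_of_stemNorm_eq_zero h
    exact hzero _ (hslice J hJ z hz) ((hrep J hJ z hz).trans h1)
  obtain ⟨J, hJ, z, rfl⟩ := exists_sliceMap_eq q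
  have hzr : ‖z‖ ≤ r := by rwa [norm_sliceMap hJ] at hq
  have hz : z ∈ Metric.ball (0 : ℂ) R := mem_ball_zero_iff.mpr (hzr.trans_lt hrR)
  have h0 : stemNorm (α 0) (β 0) = 1 := by
    have h1 := hrep J hJ 0 (Metric.mem_ball_self hR)
    have h2 := hrep (-J) (neg_mem_imaginaryUnits hJ) 0 (Metric.mem_ball_self hR)
    rw [map_zero, hf0] at h1 h2
    have hJ0 : J ≠ 0 := norm_ne_zero_iff.mp (by rw [hJ.2]; exact one_ne_zero)
    -- The values at `0` computed with `J` and `-J` coincide.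
    have h3 : (2 : ℝ) • (J * β 0) = 0 := by
      rw [two_smul]
      have h4 := h1.symm.trans h2
      rw [neg_mul, add_right_inj] at h4
      nth_rewrite 1 [h4]
      exact neg_add_cancel _
    have hβ : β 0 = 0 := by simpa [hJ0] using h3
    rw [hβ, mul_zero, add_zero] at h1
    simp [stemNorm, hβ, ← h1]
  have hlog := log_norm_ge_of_norm_le (B := M * M)
    (fun x hx => (hst x hx).differentiableAt_stemNorm.differentiableWithinAt) hne h0
    (fun x hx => (hupper J hJ x hx).trans (by gcongr; exact hM _ (hslice J hJ x hx))) hz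
  have hfpos : 0 < ‖f (sliceMap J z)‖ := norm_pos_iff.mpr (hzero _ (hslice J hJ z hz))
  have hM0 : M ≠ 0 := by positivity
  have h5 := Real.log_le_log (norm_pos_iff.mpr (hne z hz)) (hupper J hJ z hz)
  rw [Real.log_mul hfpos.ne' hM0] at h5
  rw [Real.log_mul hM0 hM0] at hlog
  have hL : 0 ≤ Real.log M := Real.log_nonneg hM1
  have h6 : 2 * (Real.log M + Real.log M) * ‖z‖ / (R - ‖z‖) ≤
      2 * (Real.log M + Real.log M) * r / (R - r) := by
    have : 0 < R - r := sub_pos.mpr hrR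
    gcongr
  have h7 : (3 * r + R) / (R - r) * Real.log M =
      2 * (Real.log M + Real.log M) * r / (R - r) + Real.log M := by
    have : R - r ≠ 0 := (sub_pos.mpr hrR).ne'
    field_simp
    ring
  rw [ge_iff_le, neg_mul, h7]
  linarith
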